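/- **Conventions.** An operator system is a complex $*$-vector space $V$ with cones $C_n\subseteq M_n(V)_h$ ($n\in\mathbb N$) satisfying $C_n\cap(-C_n)=\{0\}$ and $XC_nX^*\subseteq C_m$ for all $X\in M_{m,n}(\mathbb C)$, and with an Archimedean matrix order unit $e\in V_h$ (for every $n$, $e_n=\mathrm{diag}(e,\dots,e)$ is an Archimedean order unit of $(M_n(V),C_n)$). A u.c.p. map is a unital completely positive linear map. An inductive limit of a sequence $\mathcal S_1\xrightarrow{\phi_1}\mathcal S_2\xrightarrow{\phi_2}\cdots$ of operator systems and u.c.p. maps is an operator system $\mathcal S$ with u.c.p. maps $\phi_{k,\infty}:\mathcal S_k\to\mathcal S$ such that $\phi_{k+1,\infty}\circ\phi_k=\phi_{k,\infty}$ for all $k$ and such that, for every operator system $\mathcal R$ and u.c.p. maps $\rho_k:\mathcal S_k\to\mathcal R$ with $\rho_{k+1}\circ\phi_k=\rho_k$ for all $k$, there is a unique u.c.p. map $\mu:\mathcal S\to\mathcal R$ with $\mu\circ\phi_{k,\infty}=\rho_k$ for all $k$. A coproduct $\mathcal S\oplus_1\mathcal T$ of nonzero operator systems is an operator system with unital complete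 order embeddings $i:\mathcal S\to\mathcal S\oplus_1\mathcal T$ and $j:\mathcal T\to\mathcal S\oplus_1\mathcal T$ such that, for every operator system $\mathcal R$ and u.c.p. maps $f:\mathcal S\to\mathcal R$, $g:\mathcal T\to\mathcal R$, there is a unique u.c.p. map $h:\mathcal S\oplus_1\mathcal T\to\mathcal R$ with $h\circ i=f$ and $h\circ j=g$. For u.c.p. maps $\phi:\mathcal S\to\mathcal S'$ and $\psi:\mathcal T\to\mathcal T'$, $\phi\oplus_1\psi:\mathcal S\oplus_1\mathcal T\to\mathcal S'\oplus_1\mathcal T'$ denotes the unique u.c.p. map with $(\phi\oplus_1\psi)\circ i=i'\circ\phi$ and $(\phi\oplus_1\psi)\circ j=j'\circ\psi$. **Proposition.** Let $(\mathcal S,\{\phi_{k,\infty}\}_{k})$ and $(\mathcal T,\{\psi_{k,\infty}\}_{k})$ be inductive limits, in the category of operator systems, of the inductive systems $$\mathcal S_1\xrightarrow{\phi_1}\mathcal S_2\xrightarrow{\phi_2}\mathcal S_3\xrightarrow{\phi_3}\cdots\qquad\text{and}\qquad \mathcal T_1\xrightarrow{\psi_1}\mathcal T_2\xrightarrow{\psi_2}\mathcal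 T_3\xrightarrow{\psi_3}\cdots,$$ where $\mathcal S\neq 0$ and $\mathcal T\neq 0$ (so all $\mathcal S_k$ and $\mathcal T_k$ are nonzero). Then the coproducts $\mathcal S_k\oplus_1\mathcal T_k$ $(k\in\mathbb N)$ and $\mathcal S\oplus_1\mathcal T$ exist and, for every choice of them, the pair $(\mathcal S\oplus_1\mathcal T,\{\phi_{k,\infty}\oplus_1\psi_{k,\infty}\}_{k})$ is an inductive limit of the inductive system $$\mathcal S_1\oplus_1\mathcal T_1\xrightarrow{\phi_1\oplus_1\psi_1}\mathcal S_2\oplus_1\mathcal T_2\xrightarrow{\phi_2\oplus_1\psi_2}\mathcal S_3\oplus_1\mathcal T_3\xrightarrow{\phi_3\oplus_1\psi_3}\cdots.$$ -/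

import Mathlib

universe u

/-- An (abstract) operator system `(V, {C_n}, e)`: a complex `*`-vector space with a matrix ordering
and an Archimedean matrix order unit. `cone n` is the cone `C_n = M_n(V)⁺`; the involution of
`M_n(V)` is the conjugate transpose, so that `Matrix.IsHermitian` describes `M_n(V)_h`. -/
class OperatorSystem (V : Type u) extends AddCommGroup V, Module ℂ V, StarAddMonoid V,
    StarModule ℂ V where
  /-- the positive matrices over `V` -/
  cone : ∀ n : ℕ, Set (Matrix (Fin n) (Fin n) V)
  /-- the Archimedean matrix order unit `e` -/
  unit : V
  isHermitian_of_mem : ∀ (n : ℕ) (A : Matrix (Fin n) (Fin n) V), A ∈ cone n → A.IsHermitian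
  zero_mem : ∀ n : ℕ, (0 : Matrix (Fin n) (Fin n) V) ∈ cone n
  add_mem : ∀ (n : ℕ) (A B : Matrix (Fin n) (Fin n) V), A ∈ cone n → B ∈ cone n → A + B ∈ cone n
  smul_mem : ∀ (n : ℕ) (r : ℝ) (A : Matrix (Fin n) (Fin n) V),
    0 ≤ r → A ∈ cone n → (r : ℂ) • A ∈ cone n
  proper : ∀ (n : ℕ) (A : Matrix (Fin n) (Fin n) V), A ∈ cone n → -A ∈ cone n → A = 0
  /-- compatibility of the cones: `X C_n X^* ⊆ C_m` for every scalar `m × n` matrix `X` -/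
  compat : ∀ (m n : ℕ) (X : Matrix (Fin m) (Fin n) ℂ) (A : Matrix (Fin n) (Fin n) V), A ∈ cone n →
    (Matrix.of fun i j => ∑ k, ∑ l, (X i k * starRingEnd ℂ (X j l)) • A k l) ∈ cone m
  unit_selfAdjoint : star unit = unit
  /-- `e_n = diag(e, …, e)` is an order unit of `M_n(V)` -/
  order_unit : ∀ (n : ℕ) (A : Matrix (Fin n) (Fin n) V), A.IsHermitian →
    ∃ r : ℝ, 0 < r ∧ (r : ℂ) • Matrix.diagonal (fun _ => unit) - A ∈ cone n
  /-- the order unit `e_n` is Archimedean -/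
  archimedean : ∀ (n : ℕ) (A : Matrix (Fin n) (Fin n) V), A.IsHermitian →
    (∀ r : ℝ, 0 < r → (r : ℂ) • Matrix.diagonal (fun _ => unit) + A ∈ cone n) → A ∈ cone n

/-- Unital completely positive (u.c.p.) maps between operator systems. -/
@[ext]
structure UCPMap (V W : Type u) [OperatorSystem V] [OperatorSystem W] extends V →ₗ[ℂ] W where
  map_unit : toFun OperatorSystem.unit = OperatorSystem.unit
  map_cone : ∀ (n : ℕ) (A : Matrix (Fin n) (Fin n) V), A ∈ OperatorSystem.cone n →
    A.map toFun ∈ OperatorSystem.cone n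

/-- The composition `g ∘ f` of u.c.p. maps. -/
def UCPMap.comp {U V W : Type u} [OperatorSystem U] [OperatorSystem V] [OperatorSystem W]
    (g : UCPMap V W) (f : UCPMap U V) : UCPMap U W where
  toLinearMap := g.toLinearMap.comp f.toLinearMap
  map_unit := by
    show g.toFun (f.toFun OperatorSystem.unit) = _
    rw [f.map_unit, g.map_unit]
  map_cone := fun n A hA => g.map_cone n _ (f.map_cone n A hA)

/-- A u.c.p. map is a complete order embedding if it is a complete order isomorphism onto its range:
it is injective and its inverse, defined on the range, is completely positive for the cones that
the range inherits. -/
def UCPMap.IsCompleteOrderEmbedding {V W : Type u} [OperatorSystem V] [OperatorSystem W]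
    (f : UCPMap V W) : Prop :=
  Function.Injective f.toFun ∧
    ∀ (n : ℕ) (A : Matrix (Fin n) (Fin n) V),
      A.map f.toFun ∈ OperatorSystem.cone n → A ∈ OperatorSystem.cone n

/-- `C`, with `i : S → C` and `j : T → C`, is a coproduct `S ⊕₁ T` of the operator systems
`S` and `T`: both maps are unital complete order embeddings, and the pair is universal. -/
structure IsCoproduct {S T C : Type u} [OperatorSystem S] [OperatorSystem T] [OperatorSystem C]
    (i : UCPMap S C) (j : UCPMap T C) : Prop where
  embedding_left : i.IsCompleteOrderEmbedding
  embedding_right : j.IsCompleteOrderEmbedding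
  universal : ∀ (R : Type u) [OperatorSystem R] (f : UCPMap S R) (g : UCPMap T R),
    ∃! h : UCPMap C R, h.comp i = f ∧ h.comp j = g

/-- For coproducts `C = S ⊕₁ T` and `C' = S' ⊕₁ T'` and u.c.p. maps `φ : S → S'`, `ψ : T → T'`,
the map `φ ⊕₁ ψ : C → C'`, the unique u.c.p. map that extends `φ` and `ψ` after `S'` and `T'` are
embedded in `C'`. -/
noncomputable def IsCoproduct.map {S T C S' T' C' : Type u} [OperatorSystem S] [OperatorSystem T]
    [OperatorSystem C] [OperatorSystem S'] [OperatorSystem T'] [OperatorSystem C']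
    {i : UCPMap S C} {j : UCPMap T C} {i' : UCPMap S' C'} {j' : UCPMap T' C'}
    (h : IsCoproduct i j) (_h' : IsCoproduct i' j') (φ : UCPMap S S') (ψ : UCPMap T T') :
    UCPMap C C' :=
  (h.universal C' (i'.comp φ) (j'.comp ψ)).choose

/-- The pair `(L, {φ_{k,∞}})` is an inductive limit of the inductive system
`S_0 → S_1 → S_2 → ⋯` with the u.c.p. connecting maps `φ_k`. -/
structure IsInductiveLimit {S : ℕ → Type u} [∀ k, OperatorSystem (S k)]
    (φ : ∀ k, UCPMap (S k) (S (k + 1))) {L : Type u} [OperatorSystem L]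
    (φinf : ∀ k, UCPMap (S k) L) : Prop where
  compatible : ∀ k, (φinf (k + 1)).comp (φ k) = φinf k
  universal : ∀ (R : Type u) [OperatorSystem R] (ρ : ∀ k, UCPMap (S k) R),
    (∀ k, (ρ (k + 1)).comp (φ k) = ρ k) →
      ∃! μ : UCPMap L R, ∀ k, μ.comp (φinf k) = ρ k

/-! Colimits commute with colimits. A u.c.p. map out of `S ⊕₁ T` is a pair of u.c.p. maps out of `S`
and `T`, hence a pair of compatible families out of the `S k` and `T k`, hence a compatible family
out of the `S k ⊕₁ T k`. Only the universal properties enter, mostly through `IsCoproduct.hom_ext`.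

The substance is the existence of coproducts (`exists_coproduct`). A state `ω` of `T` splits `T` as
`ℂe ⊕ ker ω`, so `S × ker ω` is a model of `S ⊕ T` with the two units identified, and no quotient is
needed. Its cones are the Archimedeanized sums of the positive matrices over `S` and `T`. With a
state `τ` of `S`, the pairs `(id, ω(·)e)` and `(τ(·)e, id)` induce maps back to `S` and `T`. These
jointly separate points, so the cones are proper, and they are left inverses of the inclusions,
which are therefore complete order embeddings. States exist on nonzero systems by the M. Riesz
extension theorem (`exists_state`). -/

open Matrix

namespace OperatorSystem

open scoped ComplexOrder

variable {V W : Type u} [OperatorSystem V] [OperatorSystem W]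

/-! ### Scalar congruences and the matrix order unit -/

/-- The matrix `X A X^*`, for a scalar matrix `X` and a matrix `A` over a complex vector space. -/
def conjBy {E : Type*} [AddCommGroup E] [Module ℂ E] {m n : ℕ} (X : Matrix (Fin m) (Fin n) ℂ)
    (A : Matrix (Fin n) (Fin n) E) : Matrix (Fin m) (Fin m) E :=
  Matrix.of fun i j => ∑ k, ∑ l, (X i k * starRingEnd ℂ (X j l)) • A k l

section conjBy

variable {E F : Type*} [AddCommGroup E] [Module ℂ E] [AddCommGroup F] [Module ℂ F] {m n : ℕ}
  (X : Matrix (Fin m) (Fin n) ℂ)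

lemma conjBy_add (A B : Matrix (Fin n) (Fin n) E) :
    conjBy X (A + B) = conjBy X A + conjBy X B := by
  ext i j
  simp [conjBy, smul_add, Finset.sum_add_distrib]

lemma conjBy_smul (c : ℂ) (A : Matrix (Fin n) (Fin n) E) :
    conjBy X (c • A) = c • conjBy X A := by
  ext i j
  simp [conjBy, Finset.smul_sum, smul_comm c]

lemma conjBy_map (f : E →ₗ[ℂ] F) (A : Matrix (Fin n) (Fin n) E) :
    conjBy X (A.map f) = (conjBy X A).map f := by
  ext i j
  simp [conjBy, map_sum]

end conjBy

lemma conjBy_mem {m n : ℕ} (X : Matrix (Fin m) (Fin n) ℂ) {A : Matrix (Fin n) (Fin n) V}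
    (hA : A ∈ cone n) : conjBy X A ∈ cone m :=
  compat m n X A hA

/-- The matrix order unit `diag(e, …, e)`. -/
abbrev unitMatrix (V : Type u) [OperatorSystem V] (n : ℕ) : Matrix (Fin n) (Fin n) V :=
  Matrix.diagonal fun _ => unit

lemma isHermitian_diagonal_of_star {E : Type*} [AddCommGroup E] [StarAddMonoid E] {e : E}
    (he : star e = e) (n : ℕ) :
    (Matrix.diagonal fun _ : Fin n => e).IsHermitian := by
  rw [Matrix.IsHermitian, Matrix.diagonal_conjTranspose]
  congr 1
  funext i
  exact he

lemma isHermitian_real_smul {E : Type*} [AddCommGroup E] [Module ℂ E] [StarAddMonoid E]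
    [StarModule ℂ E] {n : ℕ} (r : ℝ) {A : Matrix (Fin n) (Fin n) E} (hA : A.IsHermitian) :
    ((r : ℂ) • A).IsHermitian := by
  rw [Matrix.IsHermitian, Matrix.conjTranspose_smul, hA.eq]
  simp

lemma unitMatrix_mem (n : ℕ) : unitMatrix V n ∈ cone n := by
  obtain ⟨r, hr, h⟩ := order_unit n (0 : Matrix (Fin n) (Fin n) V) Matrix.isHermitian_zero
  rw [sub_zero] at h
  have := smul_mem n r⁻¹ _ (inv_nonneg.2 hr.le) h
  rwa [smul_smul, ← Complex.ofReal_mul, inv_mul_cancel₀ hr.ne', Complex.ofReal_one,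
    one_smul] at this

/-- The Archimedean property, without assuming that the matrix is Hermitian. -/
lemma mem_cone_of_forall_pos {n : ℕ} {A : Matrix (Fin n) (Fin n) V}
    (h : ∀ r : ℝ, 0 < r → (r : ℂ) • unitMatrix V n + A ∈ cone n) : A ∈ cone n := by
  refine archimedean n A ?_ h
  have h1 := isHermitian_of_mem n _ (h 1 one_pos)
  have h2 := isHermitian_real_smul 1 (isHermitian_diagonal_of_star (unit_selfAdjoint (V := V)) n)
  simpa using h1.sub h2

lemma map_mem (f : UCPMap V W) {n : ℕ} {A : Matrix (Fin n) (Fin n) V} (hA : A ∈ cone n) :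
    A.map f.toLinearMap ∈ cone n :=
  f.map_cone n A hA

lemma ucp_map_unit (f : UCPMap V W) : f.toLinearMap unit = unit := f.map_unit

/-! ### Existence of states -/

/-- If `e = 0`, the order unit property makes every Hermitian matrix positive along with its
negative, so properness kills all self-adjoint elements, and these span `V`. -/
lemma unit_ne_zero [Nontrivial V] : (unit : V) ≠ 0 := by
  intro h0
  have key : ∀ A : Matrix (Fin 1) (Fin 1) V, A.IsHermitian → A = 0 := by
    have neg_mem : ∀ A : Matrix (Fin 1) (Fin 1) V, A.IsHermitian → -A ∈ cone 1 := by
      intro A hA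
      obtain ⟨r, -, h⟩ := order_unit 1 A hA
      simpa [h0] using h
    intro A hA
    refine proper 1 A ?_ (neg_mem A hA)
    simpa using neg_mem (-A) hA.neg
  have key' : ∀ t : V, star t = t → t = 0 := by
    intro t ht
    have := key (Matrix.diagonal fun _ => t) (isHermitian_diagonal_of_star ht 1)
    simpa using congrFun (congrFun this 0) 0
  obtain ⟨t, ht⟩ := exists_ne (0 : V)
  have h1 : t + star t = 0 := key' _ (by simp [add_comm])
  have h2 : Complex.I • (t - star t) = 0 := key' _ (by
    rw [star_smul, star_sub, star_star, Complex.star_def, Complex.conj_I, neg_smul, ← smul_neg,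
      neg_sub])
  have h3 : t - star t = 0 := by simpa using h2
  apply ht
  have h4 : (2 : ℂ) • t = 0 := by
    rw [two_smul]
    calc t + t = (t + star t) + (t - star t) := by abel
      _ = 0 := by rw [h1, h3, add_zero]
  simpa using h4

/-- A state of an operator system: a unital (completely) positive functional. -/
structure State (V : Type u) [OperatorSystem V] extends V →ₗ[ℂ] ℂ where
  map_unit : toLinearMap unit = 1
  map_star : ∀ t : V, toLinearMap (star t) = star (toLinearMap t)
  map_cone : ∀ (n : ℕ) (A : Matrix (Fin n) (Fin n) V), A ∈ cone n →
    (A.map toLinearMap).PosSemidef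

/-- The convex cone, over the reals, of the elements with positive real part. -/
def realPartCone (V : Type u) [OperatorSystem V] : PointedCone ℝ V where
  carrier := {t | Matrix.diagonal (fun _ : Fin 1 => t + star t) ∈ cone 1}
  zero_mem' := by
    show Matrix.diagonal (fun _ : Fin 1 => (0 : V) + star 0) ∈ cone 1
    simpa using zero_mem (V := V) 1
  smul_mem' := by
    rintro ⟨c, hc⟩ t ht
    have := smul_mem 1 c _ hc ht
    show Matrix.diagonal (fun _ : Fin 1 => c • t + star (c • t)) ∈ cone 1
    convert this using 1
    rw [← Matrix.diagonal_smul]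
    congr 1
    funext i
    simp [smul_add]
  add_mem' := by
    intro s t hs ht
    have := add_mem 1 _ _ hs ht
    show Matrix.diagonal (fun _ : Fin 1 => (s + t) + star (s + t)) ∈ cone 1
    convert this using 1
    rw [Matrix.diagonal_add]
    congr 1
    funext i
    simp only [star_add]
    abel

lemma mem_realPartCone {t : V} :
    t ∈ realPartCone V ↔ Matrix.diagonal (fun _ : Fin 1 => t + star t) ∈ cone 1 := Iff.rfl

/-- Riesz extension of `r e ↦ r` from the real line through `e`; the order unit supplies the
cofinality hypothesis. -/
lemma exists_realState (V : Type u) [OperatorSystem V] [Nontrivial V] :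
    ∃ g : V →ₗ[ℝ] ℝ, g unit = 1 ∧ ∀ t ∈ realPartCone V, 0 ≤ g t := by
  let f : V →ₗ.[ℝ] ℝ := LinearPMap.mkSpanSingleton (unit : V) (1 : ℝ) unit_ne_zero
  obtain ⟨g, hg, hpos⟩ := riesz_extension (realPartCone V) f (by
    rintro ⟨x, hx⟩ hxs
    obtain ⟨r, rfl⟩ := Submodule.mem_span_singleton.1 hx
    have hfr : f ⟨r • unit, hx⟩ = r := by
      have := LinearPMap.mkSpanSingleton'_apply (unit : V) (1 : ℝ)
        (fun c hc => by
          rcases smul_eq_zero.1 hc with h | h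
          · simp [h]
          · exact absurd h unit_ne_zero) r hx
      simpa [f, LinearPMap.mkSpanSingleton] using this
    rw [hfr]
    -- If `r < 0`, rescaling makes `-e` positive; as `e` is positive too, `e = 0`.
    by_contra! hr
    have h1 : ((2 * r : ℝ) : ℂ) • unitMatrix V 1 ∈ cone 1 := by
      have := mem_realPartCone.1 hxs
      convert this using 1
      rw [← Matrix.diagonal_smul]
      congr 1
      funext i
      simp only [Pi.smul_apply, star_smul, unit_selfAdjoint, star_trivial]
      rw [← two_smul ℝ, smul_smul, Complex.coe_smul]
    have h2 := smul_mem 1 (-(2 * r))⁻¹ _ (inv_nonneg.2 (by linarith)) h1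
    rw [smul_smul, ← Complex.ofReal_mul, inv_neg, neg_mul, inv_mul_cancel₀ (by linarith)] at h2
    have h3 := proper 1 _ (unitMatrix_mem (V := V) 1) (by simpa using h2)
    apply unit_ne_zero (V := V)
    simpa using congrFun (congrFun h3 0) 0) (by
    intro y
    -- The half below compensates for `t + star t` being twice the real part.
    obtain ⟨r, hr, h⟩ := order_unit 1 (Matrix.diagonal fun _ => -(y + star y))
      (isHermitian_diagonal_of_star (by simp [add_comm]) 1)
    refine ⟨⟨(r / 2) • unit, Submodule.mem_span_singleton.2 ⟨_, rfl⟩⟩, mem_realPartCone.2 ?_⟩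
    convert h using 1
    rw [← Matrix.diagonal_smul, Matrix.diagonal_sub]
    congr 1
    funext i
    simp only [Pi.smul_apply, star_add, star_smul, unit_selfAdjoint, star_trivial, Complex.coe_smul,
      sub_neg_eq_add]
    rw [add_add_add_comm, ← add_smul, add_halves])
  refine ⟨g, ?_, hpos⟩
  have h1 : (unit : V) ∈ f.domain := Submodule.mem_span_singleton_self _
  rw [hg ⟨unit, h1⟩]
  have := LinearPMap.mkSpanSingleton'_apply_self (unit : V) (1 : ℝ)
        (fun c hc => by
          rcases smul_eq_zero.1 hc with h | h
          · simp [h]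
          · exact absurd h unit_ne_zero) h1
  simpa [f, LinearPMap.mkSpanSingleton] using this

/-- The complexification `ω(t) = g(t) - i g(it)` works: `g` vanishes on skew-adjoint elements, so
`ω` is `*`-preserving. Complete positivity is automatic for functionals, because `x^* ω(A) x = ω(x^*
A x)`. -/
theorem exists_state (V : Type u) [OperatorSystem V] [Nontrivial V] : Nonempty (State V) := by
  obtain ⟨g, hg1, hpos⟩ := exists_realState V
  have skew : ∀ t : V, t + star t = 0 → g t = 0 := by
    intro t ht
    refine le_antisymm ?_ (hpos t ?_)
    · have := hpos (-t) (by
        rw [mem_realPartCone, star_neg, ← neg_add, ht]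
        simpa using zero_mem (V := V) 1)
      simpa using this
    · rw [mem_realPartCone, ht]
      simpa using zero_mem (V := V) 1
  have gstar : ∀ t : V, g (star t) = g t := by
    intro t
    have := skew (star t - t) (by simp)
    rw [map_sub] at this
    linarith
  let ω : V →ₗ[ℂ] ℂ :=
    { toFun := fun t => ⟨g t, -g (Complex.I • t)⟩
      map_add' := by
        intro s t
        apply Complex.ext
        · simp
        · simp [add_comm]
      map_smul' := by
        intro c t
        have hc : c • t = c.re • t + c.im • (Complex.I • t) := by
          conv_lhs => rw [← Complex.re_add_im c]
          rw [add_smul, mul_smul, Complex.coe_smul, Complex.coe_smul]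
        have hI : Complex.I • (c • t) = c.re • (Complex.I • t) - c.im • t := by
          rw [hc, smul_add, smul_comm Complex.I c.re, smul_comm Complex.I c.im, smul_smul,
            Complex.I_mul_I, neg_one_smul, smul_neg, sub_eq_add_neg]
        apply Complex.ext
        · simp [hc]
        · simp only [hI, map_sub, map_smul, smul_eq_mul, RingHom.id_apply, Complex.mul_im]
          ring }
  have ωre : ∀ t, (ω t).re = g t := fun t => rfl
  have ωim : ∀ t, (ω t).im = -g (Complex.I • t) := fun t => rfl
  have ωstar : ∀ t, ω (star t) = star (ω t) := by
    intro t
    apply Complex.ext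
    · simp [ωre, gstar]
    · have : Complex.I • star t = -star (Complex.I • t) := by simp
      rw [ωim, this, map_neg, gstar, Complex.star_def, Complex.conj_im, ωim]
  refine ⟨⟨ω, ?_, ωstar, ?_⟩⟩
  · apply Complex.ext
    · simp [ωre, hg1]
    · rw [ωim, skew _ (by simp [unit_selfAdjoint])]
      simp
  · intro n A hA
    have hA' := isHermitian_of_mem n A hA
    refine Matrix.PosSemidef.of_dotProduct_mulVec_nonneg ?_ ?_
    · ext i j
      simp only [Matrix.conjTranspose_apply, Matrix.map_apply, ← ωstar]
      rw [hA'.apply]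
    · intro x
      have h1 := conjBy_mem (Matrix.of fun (_ : Fin 1) k => star (x k)) hA
      set s : V := ∑ k, ∑ l, (star (x k) * x l) • A k l with hs
      have h2 : conjBy (Matrix.of fun (_ : Fin 1) k => star (x k)) A
          = Matrix.diagonal fun _ => s := by
        ext i j
        simp [conjBy, hs, Subsingleton.elim i j]
      rw [h2] at h1
      have hstar : star s = s := by
        simpa using (isHermitian_of_mem 1 _ h1).apply 0 0
      have h3 : star x ⬝ᵥ (A.map ω *ᵥ x) = ω s := by
        simp only [hs, dotProduct, Matrix.mulVec, map_sum, Finset.mul_sum, map_smul, smul_eq_mul,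
          Matrix.map_apply, Pi.star_apply]
        refine Finset.sum_congr rfl fun k _ => Finset.sum_congr rfl fun l _ => ?_
        ring
      rw [h3, Complex.le_def]
      constructor
      · refine hpos s ?_
        rw [mem_realPartCone, hstar]
        have := add_mem 1 _ _ h1 h1
        rwa [Matrix.diagonal_add] at this
      · rw [ωim, skew _ (by simp [hstar])]
        simp

/-- Writing `M = X X^*`, the matrix in question is `X e_m X^*`. -/
lemma smul_unit_mem {n : ℕ} {M : Matrix (Fin n) (Fin n) ℂ} (hM : M.PosSemidef) :
    M.map (fun c => c • (unit : V)) ∈ cone n := by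
  obtain ⟨m, v, rfl⟩ := Matrix.posSemidef_iff_eq_sum_vecMulVec.1 hM
  convert conjBy_mem (Matrix.of fun i p => v p i) (unitMatrix_mem (V := V) m) using 1
  ext i j
  simp [conjBy, Matrix.sum_apply, Matrix.vecMulVec_apply, Matrix.diagonal_apply, Finset.sum_smul]

/-- The u.c.p. map `t ↦ ω(t) e` given by a state `ω`. -/
def State.toUCPMap (ω : State V) (W : Type u) [OperatorSystem W] : UCPMap V W where
  toLinearMap := ω.toLinearMap.smulRight unit
  map_unit := by
    show ω.toLinearMap unit • (unit : W) = unit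
    rw [ω.map_unit, one_smul]
  map_cone n A hA := smul_unit_mem (V := W) (ω.map_cone n A hA)

/-- The identity, as a u.c.p. map. -/
def idUCP (V : Type u) [OperatorSystem V] : UCPMap V V where
  toLinearMap := LinearMap.id
  map_unit := rfl
  map_cone _ _ hA := hA

/-- The kernel of a state. -/
abbrev State.ker (ω : State V) : Submodule ℂ V := LinearMap.ker ω.toLinearMap

instance (ω : State V) : StarAddMonoid ω.ker where
  star x := ⟨star x.1, by rw [LinearMap.mem_ker, ω.map_star, LinearMap.mem_ker.1 x.2, star_zero]⟩
  star_involutive x := Subtype.ext (star_star x.1)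
  star_add x y := Subtype.ext (star_add x.1 y.1)

lemma State.coe_star_ker (ω : State V) (x : ω.ker) : ((star x : ω.ker) : V) = star (x : V) := rfl

instance (ω : State V) : StarModule ℂ ω.ker where
  star_smul c x := Subtype.ext (star_smul c x.1)

/-! ### The model of the coproduct on `S × ker ω` -/

namespace Coproduct

variable (S : Type u) {T : Type u} [OperatorSystem S] [OperatorSystem T] (ω : State T)

/-- The inclusion of the first summand into `S × ker ω`. -/
def inl : S →ₗ[ℂ] S × ω.ker := LinearMap.inl ℂ S ω.ker

/-- The inclusion of the second summand into `S × ker ω`, which identifies the two units. -/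
def inr : T →ₗ[ℂ] S × ω.ker where
  toFun t := (ω.toLinearMap t • unit, ⟨t - ω.toLinearMap t • unit, by
    simp [LinearMap.mem_ker, ω.map_unit]⟩)
  map_add' s t := by
    ext
    · simp [add_smul]
    · simp only [map_add, add_smul, Prod.snd_add, Submodule.coe_add]
      abel
  map_smul' c t := by
    ext
    · simp [mul_smul]
    · simp [mul_smul, smul_sub]

variable {S}

lemma inl_unit : inl S ω unit = (unit, 0) := rfl

lemma inr_unit : inr S ω unit = (unit, 0) := by
  ext <;> simp [inr, ω.map_unit]

lemma inr_coe (x : ω.ker) : inr S ω x = (0, x) := by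
  have := LinearMap.mem_ker.1 x.2
  ext <;> simp [inr, this]

lemma inl_star (s : S) : inl S ω (star s) = star (inl S ω s) := by
  ext <;> simp [inl]

lemma inr_star (t : T) : inr S ω (star t) = star (inr S ω t) := by
  ext
  · simp [inr, ω.map_star, unit_selfAdjoint]
  · simp [inr, ω.map_star, unit_selfAdjoint, State.coe_star_ker]

lemma isHermitian_map_of_star {E F : Type*} [AddCommGroup E] [Module ℂ E] [StarAddMonoid E]
    [AddCommGroup F] [Module ℂ F] [StarAddMonoid F] (f : E →ₗ[ℂ] F)
    (hf : ∀ x, f (star x) = star (f x)) {n : ℕ} {A : Matrix (Fin n) (Fin n) E}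
    (hA : A.IsHermitian) : (A.map f).IsHermitian := by
  ext i j
  simp only [Matrix.conjTranspose_apply, Matrix.map_apply, ← hf]
  rw [hA.apply]

lemma matrixMap_diagonal {E F : Type*} [AddCommGroup E] [Module ℂ E] [AddCommGroup F] [Module ℂ F]
    (f : E →ₗ[ℂ] F) (e : E) (n : ℕ) :
    (Matrix.diagonal fun _ : Fin n => e).map f = Matrix.diagonal fun _ => f e :=
  Matrix.diagonal_map (map_zero f)

lemma matrixMap_add {E F : Type*} [AddCommGroup E] [Module ℂ E] [AddCommGroup F] [Module ℂ F]
    (f : E →ₗ[ℂ] F) {n : ℕ} (A B : Matrix (Fin n) (Fin n) E) :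
    (A + B).map f = A.map f + B.map f := by
  ext i j
  simp

lemma matrixMap_sub {E F : Type*} [AddCommGroup E] [Module ℂ E] [AddCommGroup F] [Module ℂ F]
    (f : E →ₗ[ℂ] F) {n : ℕ} (A B : Matrix (Fin n) (Fin n) E) :
    (A - B).map f = A.map f - B.map f := by
  ext i j
  simp

lemma matrixMap_smul {E F : Type*} [AddCommGroup E] [Module ℂ E] [AddCommGroup F] [Module ℂ F]
    (f : E →ₗ[ℂ] F) {n : ℕ} (c : ℂ) (A : Matrix (Fin n) (Fin n) E) :
    (c • A).map f = c • A.map f := by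
  ext i j
  simp

/-- The order unit matrix of `S × ker ω`. -/
abbrev unitMat (S : Type u) [OperatorSystem S] (n : ℕ) :
    Matrix (Fin n) (Fin n) (S × ω.ker) :=
  Matrix.diagonal fun _ => (unit, 0)

/-- The sums of images of positive matrices over `S` and over `T`. -/
def preCone (S : Type u) [OperatorSystem S] (n : ℕ) : Set (Matrix (Fin n) (Fin n) (S × ω.ker)) :=
  {A | ∃ a ∈ cone (V := S) n, ∃ b ∈ cone (V := T) n, A = a.map (inl S ω) + b.map (inr S ω)}

variable {ω} {n : ℕ}

lemma preCone_add {A B : Matrix (Fin n) (Fin n) (S × ω.ker)} (hA : A ∈ preCone ω S n)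
    (hB : B ∈ preCone ω S n) : A + B ∈ preCone ω S n := by
  obtain ⟨a, ha, b, hb, rfl⟩ := hA
  obtain ⟨a', ha', b', hb', rfl⟩ := hB
  refine ⟨a + a', add_mem n _ _ ha ha', b + b', add_mem n _ _ hb hb', ?_⟩
  rw [matrixMap_add, matrixMap_add]
  abel

lemma preCone_smul {r : ℝ} (hr : 0 ≤ r) {A : Matrix (Fin n) (Fin n) (S × ω.ker)}
    (hA : A ∈ preCone ω S n) : (r : ℂ) • A ∈ preCone ω S n := by
  obtain ⟨a, ha, b, hb, rfl⟩ := hA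
  refine ⟨_, smul_mem n r a hr ha, _, smul_mem n r b hr hb, ?_⟩
  rw [matrixMap_smul, matrixMap_smul, smul_add]

lemma preCone_conjBy {m : ℕ} (X : Matrix (Fin m) (Fin n) ℂ)
    {A : Matrix (Fin n) (Fin n) (S × ω.ker)} (hA : A ∈ preCone ω S n) :
    conjBy X A ∈ preCone ω S m := by
  obtain ⟨a, ha, b, hb, rfl⟩ := hA
  refine ⟨_, conjBy_mem X ha, _, conjBy_mem X hb, ?_⟩
  rw [conjBy_add, conjBy_map, conjBy_map]

lemma inl_mem_preCone {a : Matrix (Fin n) (Fin n) S} (ha : a ∈ cone n) :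
    a.map (inl S ω) ∈ preCone ω S n :=
  ⟨a, ha, 0, zero_mem n, by ext i j <;> simp⟩

lemma inr_mem_preCone {b : Matrix (Fin n) (Fin n) T} (hb : b ∈ cone n) :
    b.map (inr S ω) ∈ preCone ω S n :=
  ⟨0, zero_mem n, b, hb, by ext i j <;> simp⟩

lemma unitMat_mem_preCone (n : ℕ) : unitMat ω S n ∈ preCone ω S n := by
  have := inl_mem_preCone (ω := ω) (unitMatrix_mem (V := S) n)
  rwa [matrixMap_diagonal, inl_unit] at this

lemma isHermitian_of_mem_preCone {A : Matrix (Fin n) (Fin n) (S × ω.ker)}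
    (hA : A ∈ preCone ω S n) : A.IsHermitian := by
  obtain ⟨a, ha, b, hb, rfl⟩ := hA
  exact (isHermitian_map_of_star _ (inl_star ω) (isHermitian_of_mem n a ha)).add
    (isHermitian_map_of_star _ (inr_star ω) (isHermitian_of_mem n b hb))

variable (ω)

/-- The Archimedeanization of `preCone`. -/
def archCone (S : Type u) [OperatorSystem S] (n : ℕ) : Set (Matrix (Fin n) (Fin n) (S × ω.ker)) :=
  {A | ∀ r : ℝ, 0 < r → (r : ℂ) • unitMat ω S n + A ∈ preCone ω S n}

variable {ω}

lemma preCone_subset_archCone : preCone ω S n ⊆ archCone ω S n := fun _ hA _ hr =>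
  preCone_add (preCone_smul hr.le (unitMat_mem_preCone n)) hA

/-- The linear map `S × ker ω → R` given by `f` on `S` and by `g` on `T`. -/
def descLinear (ω : State T) {R : Type u} [OperatorSystem R] (f : UCPMap S R) (g : UCPMap T R) :
    S × ω.ker →ₗ[ℂ] R :=
  f.toLinearMap.coprod (g.toLinearMap.comp ω.ker.subtype)

section desc

variable {R : Type u} [OperatorSystem R] (f : UCPMap S R) (g : UCPMap T R)

lemma descLinear_inl (s : S) : descLinear ω f g (inl S ω s) = f.toLinearMap s := by
  simp [descLinear, inl]

lemma descLinear_inr (t : T) : descLinear ω f g (inr S ω t) = g.toLinearMap t := by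
  simp [descLinear, inr, ucp_map_unit]

lemma descLinear_unit : descLinear ω f g (unit, 0) = unit := by
  simp [descLinear, ucp_map_unit]

/-- The image of `r e_n + A` is a sum of positive matrices for each `r > 0`, and the order unit of
`R` is Archimedean. -/
lemma descLinear_mem {A : Matrix (Fin n) (Fin n) (S × ω.ker)} (hA : A ∈ archCone ω S n) :
    A.map (descLinear ω f g) ∈ cone n := by
  refine mem_cone_of_forall_pos fun r hr => ?_
  obtain ⟨a, ha, b, hb, hab⟩ := hA r hr
  have h1 : (r : ℂ) • unitMatrix R n + A.map (descLinear ω f g)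
      = a.map f.toLinearMap + b.map g.toLinearMap := by
    have := congrArg (fun M => M.map (descLinear ω f g)) hab
    simp only [matrixMap_add, matrixMap_smul, matrixMap_diagonal, descLinear_unit] at this
    rw [this]
    ext i j
    simp [descLinear_inl, descLinear_inr]
  rw [h1]
  exact add_mem n _ _ (map_mem f ha) (map_mem g hb)

end desc

/-- Every induced map into an operator system kills `A`. The pair `(id, ω(·)e)` induces the
projection to `S`, since `ω` vanishes on `ker ω`; once the first coordinates are zero, `(τ(·)e, id)`
reads off the second. -/
lemma archCone_proper (τ : State S) {A : Matrix (Fin n) (Fin n) (S × ω.ker)}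
    (hA : A ∈ archCone ω S n) (hA' : -A ∈ archCone ω S n) : A = 0 := by
  have key : ∀ {R : Type u} [OperatorSystem R] (f : UCPMap S R) (g : UCPMap T R),
      A.map (descLinear ω f g) = 0 := by
    intro R _ f g
    refine proper n _ (descLinear_mem f g hA) ?_
    have := descLinear_mem f g hA'
    convert this using 1
    ext i j
    simp
  have h1 := key (idUCP S) (ω.toUCPMap S)
  have h2 := key (τ.toUCPMap T) (idUCP T)
  have hfst : ∀ i j, (A i j).1 = 0 := by
    intro i j
    have h := congrFun (congrFun h1 i) j
    have hk := LinearMap.mem_ker.1 (A i j).2.2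
    simpa [descLinear, idUCP, State.toUCPMap, hk] using h
  ext i j
  · exact hfst i j
  · have h := congrFun (congrFun h2 i) j
    simpa [descLinear, idUCP, State.toUCPMap, hfst] using h

/-- The operator system structure on `S × ker ω` that makes it the coproduct of `S` and `T`. -/
@[reducible]
def operatorSystem (ω : State T) (τ : State S) : OperatorSystem (S × ω.ker) where
  cone := archCone ω S
  unit := (unit, 0)
  isHermitian_of_mem n A hA := by
    have h1 := isHermitian_of_mem_preCone (hA 1 one_pos)
    have h2 := isHermitian_real_smul 1 (isHermitian_diagonal_of_star
      (e := ((unit, 0) : S × ω.ker)) (by ext <;> simp [unit_selfAdjoint]) n)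
    simpa using h1.sub h2
  zero_mem n := by
    intro r hr
    rw [add_zero]
    exact preCone_smul hr.le (unitMat_mem_preCone n)
  add_mem n A B hA hB := by
    intro r hr
    have := preCone_add (hA (r / 2) (half_pos hr)) (hB (r / 2) (half_pos hr))
    rwa [add_add_add_comm, ← add_smul, ← Complex.ofReal_add, add_halves] at this
  smul_mem n c A hc hA := by
    intro r hr
    rcases hc.eq_or_lt with rfl | hc
    · rw [Complex.ofReal_zero, zero_smul, add_zero]
      exact preCone_smul hr.le (unitMat_mem_preCone n)
    · have := preCone_smul hc.le (hA (r / c) (div_pos hr hc))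
      rwa [smul_add, smul_smul, ← Complex.ofReal_mul, mul_div_cancel₀ _ hc.ne'] at this
  proper n A hA hA' := archCone_proper τ hA hA'
  compat m n X A hA := by
    intro r hr
    change _ + conjBy X A ∈ _
    -- Choose `N` with `X e_n X^* ≤ N e_m`. Then `r e_m + X A X^*` is the sum of `(r/N)(N e_m - X
    -- e_n X^*)` and `X ((r/N) e_n + A) X^*`.
    have hX := conjBy_mem X (unitMatrix_mem (V := S) n)
    obtain ⟨N, hN, h⟩ := order_unit m _ (isHermitian_of_mem m _ hX)
    have h1 := preCone_smul (div_pos hr hN).le (inl_mem_preCone (ω := ω) h)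
    have h2 := preCone_conjBy X (hA (r / N) (div_pos hr hN))
    have h3 := preCone_add h1 h2
    convert h3 using 1
    rw [matrixMap_sub, matrixMap_smul, ← conjBy_map, matrixMap_diagonal, matrixMap_diagonal, inl_unit, conjBy_add,
      conjBy_smul, smul_sub, smul_smul, ← Complex.ofReal_mul, div_mul_cancel₀ _ hN.ne']
    abel
  unit_selfAdjoint := by ext <;> simp [unit_selfAdjoint]
  order_unit n A hA := by
    -- The two components of `A` are bounded separately, in `S` and in `T`; the bounds add because
    -- the units are identified.
    have ha : (A.map (LinearMap.fst ℂ S ω.ker)).IsHermitian :=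
      isHermitian_map_of_star _ (fun x => rfl) hA
    have hb : (A.map (ω.ker.subtype.comp (LinearMap.snd ℂ S ω.ker))).IsHermitian :=
      isHermitian_map_of_star _ (fun x => rfl) hA
    obtain ⟨r, hr, h⟩ := order_unit n _ ha
    obtain ⟨s, hs, k⟩ := order_unit n _ hb
    refine ⟨r + s, add_pos hr hs, preCone_subset_archCone ⟨_, h, _, k, ?_⟩⟩
    rw [matrixMap_sub, matrixMap_sub, matrixMap_smul, matrixMap_smul, matrixMap_diagonal, matrixMap_diagonal, inl_unit, inr_unit,
      sub_add_sub_comm, ← add_smul, ← Complex.ofReal_add]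
    congr 1
    ext i j <;> simp [inl, inr_coe]
  archimedean n A _ hA := by
    intro r hr
    have := hA (r / 2) (half_pos hr) (r / 2) (half_pos hr)
    rwa [← add_assoc, ← add_smul, ← Complex.ofReal_add, add_halves] at this

end Coproduct

/-! ### Existence of coproducts -/

lemma isCompleteOrderEmbedding_of_leftInverse {f : UCPMap V W} (g : UCPMap W V)
    (h : ∀ x, g.toLinearMap (f.toLinearMap x) = x) : f.IsCompleteOrderEmbedding := by
  refine ⟨Function.LeftInverse.injective (g := g.toLinearMap) h, fun n A hA => ?_⟩
  convert map_mem g hA using 1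
  ext i j
  exact (h _).symm

theorem exists_coproduct (S T : Type u) [OperatorSystem S] [OperatorSystem T] [Nontrivial S]
    [Nontrivial T] :
    ∃ (D : Type u) (_ : OperatorSystem D) (i : UCPMap S D) (j : UCPMap T D),
      IsCoproduct i j := by
  obtain ⟨τ⟩ := exists_state S
  obtain ⟨ω⟩ := exists_state T
  let inst : OperatorSystem (S × ω.ker) := Coproduct.operatorSystem ω τ
  let i : UCPMap S (S × ω.ker) :=
    { toLinearMap := Coproduct.inl S ω
      map_unit := rfl
      map_cone := fun n A hA =>
        Coproduct.preCone_subset_archCone (Coproduct.inl_mem_preCone hA) }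
  let j : UCPMap T (S × ω.ker) :=
    { toLinearMap := Coproduct.inr S ω
      map_unit := Coproduct.inr_unit ω
      map_cone := fun n A hA =>
        Coproduct.preCone_subset_archCone (Coproduct.inr_mem_preCone hA) }
  let desc : ∀ {R : Type u} [OperatorSystem R], UCPMap S R → UCPMap T R → UCPMap (S × ω.ker) R :=
    fun f g =>
      { toLinearMap := Coproduct.descLinear ω f g
        map_unit := Coproduct.descLinear_unit f g
        map_cone := fun n A hA => Coproduct.descLinear_mem f g hA }
  refine ⟨S × ω.ker, inst, i, j, ?_, ?_, ?_⟩
  · exact isCompleteOrderEmbedding_of_leftInverse (desc (idUCP S) (ω.toUCPMap S))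
      (Coproduct.descLinear_inl _ _)
  · exact isCompleteOrderEmbedding_of_leftInverse (desc (τ.toUCPMap T) (idUCP T))
      (Coproduct.descLinear_inr _ _)
  · intro R _ f g
    refine ⟨desc f g, ⟨?_, ?_⟩, ?_⟩
    · ext s
      exact Coproduct.descLinear_inl f g s
    · ext t
      exact Coproduct.descLinear_inr f g t
    · rintro h ⟨rfl, rfl⟩
      ext x
      -- The two images span the model, which forces uniqueness.
      have hx : x = Coproduct.inl S ω x.1 + Coproduct.inr S ω x.2 := by
        rw [Coproduct.inr_coe]
        ext <;> simp [Coproduct.inl]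
      show h.toLinearMap x = h.toLinearMap (Coproduct.inl S ω x.1)
        + h.toLinearMap (Coproduct.inr S ω x.2)
      rw [← map_add, ← hx]

/-- Passes nontriviality from the limits back to every `S k` and `T k`, as the existence of their
coproducts requires. -/
lemma nontrivial_of_ucpMap [Nontrivial W] (f : UCPMap V W) : Nontrivial V := by
  refine ⟨unit, 0, fun h => unit_ne_zero (V := W) ?_⟩
  rw [← ucp_map_unit f, h, map_zero]

end OperatorSystem

/-! ### Coproducts of inductive limits -/

lemma UCPMap.comp_assoc {U V W X : Type u} [OperatorSystem U] [OperatorSystem V]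
    [OperatorSystem W] [OperatorSystem X] (h : UCPMap W X) (g : UCPMap V W) (f : UCPMap U V) :
    (h.comp g).comp f = h.comp (g.comp f) := rfl

namespace IsCoproduct

variable {S T C S' T' C' R : Type u} [OperatorSystem S] [OperatorSystem T]
  [OperatorSystem C] [OperatorSystem S'] [OperatorSystem T'] [OperatorSystem C'] [OperatorSystem R]
  {i : UCPMap S C} {j : UCPMap T C} {i' : UCPMap S' C'} {j' : UCPMap T' C'}

lemma map_comp_left (h : IsCoproduct i j) (h' : IsCoproduct i' j') (φ : UCPMap S S')
    (ψ : UCPMap T T') : (h.map h' φ ψ).comp i = i'.comp φ :=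
  (h.universal C' (i'.comp φ) (j'.comp ψ)).choose_spec.1.1

lemma map_comp_right (h : IsCoproduct i j) (h' : IsCoproduct i' j') (φ : UCPMap S S')
    (ψ : UCPMap T T') : (h.map h' φ ψ).comp j = j'.comp ψ :=
  (h.universal C' (i'.comp φ) (j'.comp ψ)).choose_spec.1.2

lemma hom_ext (h : IsCoproduct i j) {f g : UCPMap C R} (hi : f.comp i = g.comp i)
    (hj : f.comp j = g.comp j) : f = g :=
  (h.universal R (g.comp i) (g.comp j)).unique ⟨hi, hj⟩ ⟨rfl, rfl⟩

end IsCoproduct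

theorem proposition6p2 {S T : ℕ → Type u}
    [∀ k, OperatorSystem (S k)] [∀ k, OperatorSystem (T k)]
    (φ : ∀ k, UCPMap (S k) (S (k + 1))) (ψ : ∀ k, UCPMap (T k) (T (k + 1)))
    {Sinf Tinf : Type u} [OperatorSystem Sinf] [OperatorSystem Tinf]
    [Nontrivial Sinf] [Nontrivial Tinf]
    (φinf : ∀ k, UCPMap (S k) Sinf) (ψinf : ∀ k, UCPMap (T k) Tinf)
    (hS : IsInductiveLimit φ φinf) (hT : IsInductiveLimit ψ ψinf) :
    -- the coproducts `S_k ⊕₁ T_k` and `S ⊕₁ T` exist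
    (∀ k, ∃ (D : Type u) (_ : OperatorSystem D) (i : UCPMap (S k) D) (j : UCPMap (T k) D),
      IsCoproduct i j) ∧
    (∃ (D : Type u) (_ : OperatorSystem D) (i : UCPMap Sinf D) (j : UCPMap Tinf D),
      IsCoproduct i j) ∧
    -- whichever coproducts are taken, `(S ⊕₁ T, {φ_{k,∞} ⊕₁ ψ_{k,∞}})` is an inductive limit
    ∀ (C : ℕ → Type u) [∀ k, OperatorSystem (C k)]
      (i : ∀ k, UCPMap (S k) (C k)) (j : ∀ k, UCPMap (T k) (C k))
      (hC : ∀ k, IsCoproduct (i k) (j k))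
      (Cinf : Type u) [OperatorSystem Cinf] (iinf : UCPMap Sinf Cinf) (jinf : UCPMap Tinf Cinf)
      (hCinf : IsCoproduct iinf jinf),
      IsInductiveLimit (fun k => (hC k).map (hC (k + 1)) (φ k) (ψ k))
        (fun k => (hC k).map hCinf (φinf k) (ψinf k)) := by 
  have hSk : ∀ k, Nontrivial (S k) := fun k => OperatorSystem.nontrivial_of_ucpMap (φinf k)
  have hTk : ∀ k, Nontrivial (T k) := fun k => OperatorSystem.nontrivial_of_ucpMap (ψinf k)
  refine ⟨fun k => OperatorSystem.exists_coproduct (S k) (T k),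
    OperatorSystem.exists_coproduct Sinf Tinf, ?_⟩
  intro C _ i j hC Cinf _ iinf jinf hCinf
  refine ⟨fun k => (hC k).hom_ext ?_ ?_, fun R _ ρ hρ => ?_⟩
  · rw [UCPMap.comp_assoc, IsCoproduct.map_comp_left, ← UCPMap.comp_assoc,
      IsCoproduct.map_comp_left, IsCoproduct.map_comp_left, UCPMap.comp_assoc, hS.compatible]
  · rw [UCPMap.comp_assoc, IsCoproduct.map_comp_right, ← UCPMap.comp_assoc,
      IsCoproduct.map_comp_right, IsCoproduct.map_comp_right, UCPMap.comp_assoc, hT.compatible]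
  · obtain ⟨f, hf, hf'⟩ := hS.universal R (fun k => (ρ k).comp (i k)) (fun k => by
      rw [UCPMap.comp_assoc, ← (hC k).map_comp_left (hC (k + 1)) (φ k) (ψ k),
        ← UCPMap.comp_assoc, hρ])
    obtain ⟨g, hg, hg'⟩ := hT.universal R (fun k => (ρ k).comp (j k)) (fun k => by
      rw [UCPMap.comp_assoc, ← (hC k).map_comp_right (hC (k + 1)) (φ k) (ψ k),
        ← UCPMap.comp_assoc, hρ])
    obtain ⟨μ, ⟨hμi, hμj⟩, -⟩ := hCinf.universal R f g
    refine ⟨μ, fun k => (hC k).hom_ext ?_ ?_, fun ν hν => hCinf.hom_ext ?_ ?_⟩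
    · rw [UCPMap.comp_assoc, IsCoproduct.map_comp_left, ← UCPMap.comp_assoc, hμi, hf]
    · rw [UCPMap.comp_assoc, IsCoproduct.map_comp_right, ← UCPMap.comp_assoc, hμj, hg]
    -- Uniqueness: `ν` restricted to `Sinf` induces the same family on the `S k` as `f`, hence
    -- equals `f`; likewise for `Tinf` and `g`.
    · rw [hμi]
      refine hf' _ fun k => ?_
      rw [UCPMap.comp_assoc, ← (hC k).map_comp_left hCinf (φinf k) (ψinf k),
        ← UCPMap.comp_assoc, hν]
    · rw [hμj]
      refine hg' _ fun k => ?_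
      rw [UCPMap.comp_assoc, ← (hC k).map_comp_right hCinf (φinf k) (ψinf k),
        ← UCPMap.comp_assoc, hν]
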